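/- Let $G$ be a group and let $\mathrm{Core}(G)$ be the quandle on the set $G$ with operation $x*y=xy^{-1}x$. Then $\mathrm{Core}(G)$ is solvable (respectively nilpotent) in the sense of commutator theory if and only if the group $G$ is solvable (respectively nilpotent). Here, for congruences $\alpha,\beta,\delta$ of a rack $Q$ (regarded as an algebra with multiplication $*$ and left division $\backslash$), one says that $\alpha$ centralizes $\beta$ over $\delta$ if for every term $t(x_1,\dots,x_m,y_1,\dots,y_n)$ and all tuples with $a_i\mathrel{\alpha}b_i$ and $c_j\mathrel{\beta}d_j$, the relation $t(a,c)\mathrel{\delta}t(a,d)$ implies $t(b,c)\mathrel{\delta}t(b,d)$. The commutator $[\alpha,\beta]$ is the smallest congruence $\delta$ such that $\alpha$ centralizes $\beta$ over $\delta$. Write $0_Q$ for the equality relation and $1_Q$ for the full relation on $Q$. The rack $Q$ is solvable if $\gamma^{n}=0_Q$ for some $n$, where $\gamma^{0}=1_Q$ and $\gamma^{i+1}=[\gamma^{i},\gamma^{i}]$; it is nilpotent if $\gamma_{n}=0_Q$ for some $n$, where $\gamma_{0}=1_Q$ and $\gamma_{i+1}=[\gamma_{i},1_Q]$. -/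

import Mathlib

open scoped Quandles

/-- The underlying set of the core of a group `G`: a copy of the set `G`. -/
@[ext]
structure GroupCore (G : Type*) where
  /-- The element of the core given by an element of the group. -/
  of ::
  /-- The underlying element of the group. -/
  val : G

/-- The core quandle of a group `G`: the set `G` with the operation `x ◃ y = x y⁻¹ x`. Every left
translation is an involution, so the left division is the same operation. -/
instance GroupCore.quandle (G : Type*) [Group G] : Quandle (GroupCore G) where
  act x y := ⟨x.val * y.val⁻¹ * x.val⟩
  invAct x y := ⟨x.val * y.val⁻¹ * x.val⟩
  self_distrib := by intros; ext; simp [mul_assoc]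
  left_inv x y := by ext; simp [mul_assoc]
  right_inv x y := by ext; simp [mul_assoc]
  fix := by intros; ext; simp

/-- Terms in the language of racks (multiplication and left division), with variables in `X`. -/
inductive RackTerm (X : Type*) where
  | var : X → RackTerm X
  | act : RackTerm X → RackTerm X → RackTerm X
  | invAct : RackTerm X → RackTerm X → RackTerm X

/-- The value of a term in a rack `Q` under an assignment of its variables. -/
def RackTerm.eval {X Q : Type*} [Rack Q] (v : X → Q) : RackTerm X → Q
  | .var x => v x
  | .act s t => RackTerm.eval v s ◃ RackTerm.eval v t
  | .invAct s t => RackTerm.eval v s ◃⁻¹ RackTerm.eval v t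

/-- Congruences of a rack: equivalence relations compatible with multiplication and left
division. -/
structure RackCon (Q : Type*) [Rack Q] extends Setoid Q where
  act_congr : ∀ {a b c d : Q}, r a b → r c d → r (a ◃ c) (b ◃ d)
  invAct_congr : ∀ {a b c d : Q}, r a b → r c d → r (a ◃⁻¹ c) (b ◃⁻¹ d)

namespace RackCon

/-- The full congruence `1_Q`. -/
def full (Q : Type*) [Rack Q] : RackCon Q where
  r _ _ := True
  iseqv := ⟨fun _ => trivial, fun _ => trivial, fun _ _ => trivial⟩
  act_congr _ _ := trivial
  invAct_congr _ _ := trivial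

/-- The identity congruence `0_Q`. -/
def zero (Q : Type*) [Rack Q] : RackCon Q where
  r x y := x = y
  iseqv := ⟨fun _ => rfl, fun h => h.symm, fun h k => h.trans k⟩
  act_congr h k := by subst h; subst k; rfl
  invAct_congr h k := by subst h; subst k; rfl

/-- `Centralizes α β δ` is the term condition `C(α, β; δ)`: for every term `t(x₁,…,xₘ,y₁,…,yₙ)`
and all tuples `a α b`, `c β d`, if `t(a, c) δ t(a, d)` then `t(b, c) δ t(b, d)`. -/
def Centralizes {Q : Type*} [Rack Q] (α β δ : RackCon Q) : Prop :=
  ∀ (m n : ℕ) (t : RackTerm (Fin m ⊕ Fin n)) (a b : Fin m → Q) (c d : Fin n → Q),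
    (∀ i, α.r (a i) (b i)) → (∀ j, β.r (c j) (d j)) →
    δ.r (t.eval (Sum.elim a c)) (t.eval (Sum.elim a d)) →
    δ.r (t.eval (Sum.elim b c)) (t.eval (Sum.elim b d))

/-- The commutator `[α, β]`: the intersection of all congruences `δ` with `C(α, β; δ)`. It is the
smallest such congruence, see `centralizes_commutator` and `commutator_le`. -/
def commutator {Q : Type*} [Rack Q] (α β : RackCon Q) : RackCon Q where
  r x y := ∀ δ : RackCon Q, Centralizes α β δ → δ.r x y
  iseqv := ⟨fun x δ _ => δ.iseqv.refl x, fun h δ hδ => δ.iseqv.symm (h δ hδ),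
    fun h k δ hδ => δ.iseqv.trans (h δ hδ) (k δ hδ)⟩
  act_congr h k δ hδ := δ.act_congr (h δ hδ) (k δ hδ)
  invAct_congr h k δ hδ := δ.invAct_congr (h δ hδ) (k δ hδ)

theorem centralizes_commutator {Q : Type*} [Rack Q] (α β : RackCon Q) :
    Centralizes α β (commutator α β) :=
  fun m n t a b c d hab hcd h δ hδ => hδ m n t a b c d hab hcd (h δ hδ)

theorem commutator_le {Q : Type*} [Rack Q] {α β δ : RackCon Q} (hδ : Centralizes α β δ) {x y : Q}
    (h : (commutator α β).r x y) : δ.r x y :=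
  h δ hδ

/-- The derived series of congruences: `γ⁰ = 1_Q` and `γⁿ⁺¹ = [γⁿ, γⁿ]`. -/
def derivedSeries (Q : Type*) [Rack Q] : ℕ → RackCon Q
  | 0 => full Q
  | n + 1 => commutator (derivedSeries Q n) (derivedSeries Q n)

/-- The lower central series of congruences: `γ₀ = 1_Q` and `γₙ₊₁ = [γₙ, 1_Q]`. -/
def lowerCentralSeries (Q : Type*) [Rack Q] : ℕ → RackCon Q
  | 0 => full Q
  | n + 1 => commutator (lowerCentralSeries Q n) (full Q)

end RackCon

/-- A rack is solvable, in the sense of commutator theory, if its derived series of congruences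
reaches `0_Q` after finitely many steps. -/
def RackIsSolvable (Q : Type*) [Rack Q] : Prop :=
  ∃ n : ℕ, RackCon.derivedSeries Q n = RackCon.zero Q

/-- A rack is nilpotent, in the sense of commutator theory, if its lower central series of
congruences reaches `0_Q` after finitely many steps. -/
def RackIsNilpotent (Q : Type*) [Rack Q] : Prop :=
  ∃ n : ℕ, RackCon.lowerCentralSeries Q n = RackCon.zero Q

/-! From `G` to its core: modulo `⁅N, M⁆` the images of `N` and `M` commute, so the coset
congruences satisfy the term condition over `⁅N, M⁆` (`centralizes_conOfNormal`). The congruence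
series thus lie below the cosets of the group series. Conversely, the term condition controls the
displacement group: `⁅relDisp α, relDisp β⁆` acts trivially modulo `[α, β]`, and commutators of
`dispKer α` with left multiplications lie in `relDisp α`. Hence one congruence commutator bounds two
group commutators, and a solvable or nilpotent rack has such a displacement group. For the core, the
subgroup of `G × G` generated by the pairs `(x, x⁻¹)` is a central extension of a subgroup of it and
projects onto `G`. -/

theorem perm_apply_inv_self {X : Type*} (g : Equiv.Perm X) (x : X) : g (g⁻¹ x) = x :=
  g.apply_symm_apply x

theorem perm_inv_apply_self {X : Type*} (g : Equiv.Perm X) (x : X) : g⁻¹ (g x) = x :=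
  g.symm_apply_apply x

/-! ### Displacement groups and congruence commutators -/

namespace RackCon

variable {Q : Type*} [Rack Q]

theorem refl (α : RackCon Q) (x : Q) : α.r x x := α.iseqv.refl x

theorem symm (α : RackCon Q) {x y : Q} (h : α.r x y) : α.r y x := α.iseqv.symm h

theorem trans (α : RackCon Q) {x y z : Q} (h : α.r x y) (k : α.r y z) : α.r x z :=
  α.iseqv.trans h k

/-- The left multiplication group of a rack. -/
def leftMulGroup (Q : Type*) [Rack Q] : Subgroup (Equiv.Perm Q) :=
  Subgroup.closure (Set.range (Rack.act' (R := Q)))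

theorem act'_mem_leftMulGroup (x : Q) : Rack.act' x ∈ leftMulGroup Q :=
  Subgroup.subset_closure ⟨x, rfl⟩

theorem rel_apply_of_mem_leftMulGroup (α : RackCon Q) {g : Equiv.Perm Q}
    (hg : g ∈ leftMulGroup Q) :
    ∀ {x y : Q}, α.r x y → α.r (g x) (g y) ∧ α.r (g⁻¹ x) (g⁻¹ y) := by
  induction hg using Subgroup.closure_induction with
  | mem g hg =>
    obtain ⟨z, rfl⟩ := hg
    exact fun h => ⟨α.act_congr (α.refl z) h, α.invAct_congr (α.refl z) h⟩
  | one => exact fun h => ⟨h, h⟩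
  | mul g k _ _ ihg ihk =>
    intro x y h
    refine ⟨(ihg (ihk h).1).1, ?_⟩
    rw [mul_inv_rev]
    exact (ihk (ihg h).2).2
  | inv g _ ih =>
    intro x y h
    rw [inv_inv]
    exact (ih h).symm

theorem conj_act' {g : Equiv.Perm Q} (hg : g ∈ leftMulGroup Q) :
    ∀ x : Q, g * Rack.act' x * g⁻¹ = Rack.act' (g x) := by
  induction hg using Subgroup.closure_induction with
  | mem g hg =>
    obtain ⟨z, rfl⟩ := hg
    exact fun x => (Rack.ad_conj z x).symm
  | one => intro x; simp
  | mul g k _ _ ihg ihk =>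
    intro x
    rw [Equiv.Perm.mul_apply, ← ihg, ← ihk]
    group
  | inv g _ ih =>
    intro x
    have h := ih (g⁻¹ x)
    rw [perm_apply_inv_self] at h
    rw [← h]
    group

/-- The relative displacement group of a congruence. -/
def relDisp (α : RackCon Q) : Subgroup (Equiv.Perm Q) :=
  Subgroup.closure {g | ∃ x y, α.r x y ∧ Rack.act' x * (Rack.act' y)⁻¹ = g}

theorem act'_mul_inv_mem_relDisp (α : RackCon Q) {x y : Q} (h : α.r x y) :
    Rack.act' x * (Rack.act' y)⁻¹ ∈ relDisp α :=
  Subgroup.subset_closure ⟨x, y, h, rfl⟩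

theorem relDisp_le_leftMulGroup (α : RackCon Q) : relDisp α ≤ leftMulGroup Q := by
  rw [relDisp, Subgroup.closure_le]
  rintro _ ⟨x, y, -, rfl⟩
  exact mul_mem (act'_mem_leftMulGroup x) (inv_mem (act'_mem_leftMulGroup y))

theorem conj_mem_relDisp (α : RackCon Q) {g h : Equiv.Perm Q} (hg : g ∈ leftMulGroup Q)
    (hh : h ∈ relDisp α) : g * h * g⁻¹ ∈ relDisp α := by
  induction hh using Subgroup.closure_induction with
  | mem h hh =>
    obtain ⟨x, y, hxy, rfl⟩ := hh
    have : g * (Rack.act' x * (Rack.act' y)⁻¹) * g⁻¹ =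
        (g * Rack.act' x * g⁻¹) * (g * Rack.act' y * g⁻¹)⁻¹ := by group
    rw [this, conj_act' hg, conj_act' hg]
    exact act'_mul_inv_mem_relDisp α (rel_apply_of_mem_leftMulGroup α hg hxy).1
  | one => simp
  | mul h k _ _ ihh ihk =>
    have : g * (h * k) * g⁻¹ = (g * h * g⁻¹) * (g * k * g⁻¹) := by group
    exact this ▸ mul_mem ihh ihk
  | inv h _ ih =>
    have : g * h⁻¹ * g⁻¹ = (g * h * g⁻¹)⁻¹ := by group
    exact this ▸ inv_mem ih

/-- The elements of the left multiplication group that act trivially modulo a congruence. -/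
def dispKer (α : RackCon Q) : Subgroup (Equiv.Perm Q) where
  carrier := {g | g ∈ leftMulGroup Q ∧ ∀ q, α.r (g q) q}
  one_mem' := ⟨one_mem _, α.refl⟩
  mul_mem' := fun {g h} hg hh => ⟨mul_mem hg.1 hh.1, fun q => α.trans (hg.2 (h q)) (hh.2 q)⟩
  inv_mem' := fun {g} hg => ⟨inv_mem hg.1, fun q => α.symm (by simpa using hg.2 (g⁻¹ q))⟩

theorem dispKer_zero : dispKer (zero Q) = ⊥ := by
  refine (Subgroup.eq_bot_iff_forall _).2 fun g hg => ?_
  ext q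
  exact hg.2 q

/-- On generators, `g L_x g⁻¹ L_x⁻¹ = L_{g x} L_x⁻¹` with `g x` congruent to `x`; normality of
`relDisp α` under left multiplications does the rest. -/
theorem commutator_dispKer_leftMulGroup_le (α : RackCon Q) :
    ⁅dispKer α, leftMulGroup Q⁆ ≤ relDisp α := by
  refine Subgroup.commutator_le.2 fun g hg h hh => ?_
  rw [commutatorElement_def]
  induction hh using Subgroup.closure_induction with
  | mem h hh =>
    obtain ⟨x, rfl⟩ := hh
    rw [conj_act' hg.1]
    exact act'_mul_inv_mem_relDisp α (hg.2 x)
  | one => simp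
  | mul h k hh _ ihh ihk =>
    have : g * (h * k) * g⁻¹ * (h * k)⁻¹ =
        (g * h * g⁻¹ * h⁻¹) * (h * (g * k * g⁻¹ * k⁻¹) * h⁻¹) := by group
    exact this ▸ mul_mem ihh (conj_mem_relDisp α hh ihk)
  | inv h hh ih =>
    have : g * h⁻¹ * g⁻¹ * h⁻¹⁻¹ = h⁻¹ * (g * h * g⁻¹ * h⁻¹)⁻¹ * h⁻¹⁻¹ := by group
    exact this ▸ conj_mem_relDisp α (inv_mem hh) (inv_mem ih)

theorem Centralizes.rel_conj_act' {α β δ : RackCon Q} (hC : Centralizes α β δ) {u v c d : Q}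
    (huv : α.r u v) (hcd : β.r c d) (q : Q) :
    δ.r (u ◃ v ◃⁻¹ c ◃ d ◃⁻¹ v ◃ u ◃⁻¹ q) (c ◃ d ◃⁻¹ q) := by
  have hz : β.r (c ◃ d ◃⁻¹ q) q := by
    have := β.act_congr hcd (β.refl (d ◃⁻¹ q))
    rwa [Rack.act_invAct_eq] at this
  -- The term is `g h g⁻¹` applied to the last variable, with `g = L_{x₀} L_{x₁}⁻¹`, `h = L_{y₀}
  -- L_{x₂}⁻¹`. At `x₀ = v` the factor `g` vanishes, and moving `q` to `h q` offsets replacing `c`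
  -- by `d`, so the premise is an equality.
  have key := hC 3 2
    (.act (.var (.inl 0)) (.invAct (.var (.inl 1)) (.act (.var (.inr 0))
      (.invAct (.var (.inl 2)) (.act (.var (.inl 1)) (.invAct (.var (.inl 0))
        (.var (.inr 1))))))))
    ![v, v, d] ![u, v, d] ![c, q] ![d, c ◃ d ◃⁻¹ q]
    (by
      intro i
      fin_cases i
      exacts [α.symm huv, α.refl _, α.refl _])
    (by
      intro j
      fin_cases j
      exacts [hcd, β.symm hz])
  simp only [RackTerm.eval, Sum.elim_inl, Sum.elim_inr, Matrix.cons_val, Rack.act_invAct_eq,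
    Rack.invAct_act_eq] at key
  exact key (δ.refl _)

theorem Centralizes.commutator_relDisp_le {α β δ : RackCon Q} (hC : Centralizes α β δ) :
    ⁅relDisp α, relDisp β⁆ ≤ dispKer δ := by
  have hα := relDisp_le_leftMulGroup α
  have hβ := relDisp_le_leftMulGroup β
  suffices H : ∀ g ∈ relDisp α, ∀ h ∈ relDisp β, ∀ q, δ.r (g (h (g⁻¹ q))) (h q) by
    refine Subgroup.commutator_le.2 fun g hg h hh => ⟨?_, fun q => ?_⟩
    · rw [commutatorElement_def]
      exact mul_mem (mul_mem (mul_mem (hα hg) (hβ hh)) (inv_mem (hα hg))) (inv_mem (hβ hh))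
    · simpa [commutatorElement_def] using H g hg h hh (h⁻¹ q)
  intro g hg
  induction hg using Subgroup.closure_induction with
  | mem g hg =>
    obtain ⟨u, v, huv, rfl⟩ := hg
    intro h hh
    induction hh using Subgroup.closure_induction with
    | mem h hh =>
      obtain ⟨c, d, hcd, rfl⟩ := hh
      intro q
      simpa using hC.rel_conj_act' huv hcd q
    | one => intro q; simp
    | mul h k hh _ ihh ihk =>
      intro q
      have h₁ := ihh ((Rack.act' u * (Rack.act' v)⁻¹)
        (k ((Rack.act' u * (Rack.act' v)⁻¹)⁻¹ q)))
      rw [perm_inv_apply_self] at h₁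
      exact δ.trans h₁ (rel_apply_of_mem_leftMulGroup δ (hβ hh) (ihk q)).1
    | inv h hh ih =>
      intro q
      have h₁ := ih ((Rack.act' u * (Rack.act' v)⁻¹)
        (h⁻¹ ((Rack.act' u * (Rack.act' v)⁻¹)⁻¹ q)))
      rw [perm_inv_apply_self, perm_apply_inv_self, perm_apply_inv_self] at h₁
      have h₂ := (rel_apply_of_mem_leftMulGroup δ (hβ hh) h₁).2
      rw [perm_inv_apply_self] at h₂
      exact δ.symm h₂
  | one => exact fun h _ q => δ.refl (h q)
  | mul g k hg _ ihg ihk =>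
    intro h hh q
    rw [mul_inv_rev]
    exact δ.trans (rel_apply_of_mem_leftMulGroup δ (hα hg) (ihk h hh (g⁻¹ q))).1 (ihg h hh q)
  | inv g hg ih =>
    intro h hh q
    have h₁ := (rel_apply_of_mem_leftMulGroup δ (hα hg) (ih h hh (g q))).2
    rw [perm_inv_apply_self, perm_inv_apply_self] at h₁
    rw [inv_inv]
    exact δ.symm h₁

/-- The displacement group of a rack. -/
abbrev disp (Q : Type*) [Rack Q] : Subgroup (Equiv.Perm Q) := relDisp (full Q)

/-- The factor 2: one bracket goes from `dispKer` to `relDisp`, the next to the `dispKer` of the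
following term. -/
theorem disp_lowerCentralSeries_le (n : ℕ) :
    (disp Q).lowerCentralSeries (2 * n) ≤ dispKer (lowerCentralSeries Q n) := by
  induction n with
  | zero => exact fun g hg => ⟨relDisp_le_leftMulGroup _ hg, fun _ => trivial⟩
  | succ n ih =>
    rw [show 2 * (n + 1) = 2 * n + 1 + 1 from rfl, Subgroup.lowerCentralSeries_succ,
      Subgroup.lowerCentralSeries_succ]
    exact (Subgroup.commutator_mono ((Subgroup.commutator_mono ih
      (relDisp_le_leftMulGroup _)).trans (commutator_dispKer_leftMulGroup_le _)) le_rfl).trans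
      (centralizes_commutator _ _).commutator_relDisp_le

theorem map_derivedSeries_disp_le (n : ℕ) :
    (_root_.derivedSeries (disp Q) (2 * n)).map (disp Q).subtype ≤
      dispKer (derivedSeries Q n) := by
  induction n with
  | zero =>
    rintro _ ⟨g, -, rfl⟩
    exact ⟨relDisp_le_leftMulGroup _ g.2, fun _ => trivial⟩
  | succ n ih =>
    have h : (_root_.derivedSeries (disp Q) (2 * n + 1)).map (disp Q).subtype ≤
        relDisp (derivedSeries Q n) := by
      rw [derivedSeries_succ, Subgroup.map_commutator]
      exact (Subgroup.commutator_mono ih (ih.trans fun g hg => hg.1)).trans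
        (commutator_dispKer_leftMulGroup_le _)
    rw [show 2 * (n + 1) = 2 * n + 1 + 1 from rfl, derivedSeries_succ, Subgroup.map_commutator]
    exact (Subgroup.commutator_mono h h).trans
      (centralizes_commutator _ _).commutator_relDisp_le

theorem isNilpotent_disp (h : RackIsNilpotent Q) : Group.IsNilpotent (disp Q) := by
  obtain ⟨n, hn⟩ := h
  have := disp_lowerCentralSeries_le (Q := Q) n
  rw [hn, dispKer_zero, le_bot_iff] at this
  exact Subgroup.isNilpotent_of_lowerCentralSeries_eq_bot this

theorem isSolvable_disp (h : RackIsSolvable Q) : Group.IsSolvable (disp Q) := by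
  obtain ⟨n, hn⟩ := h
  have := map_derivedSeries_disp_le (Q := Q) n
  rw [hn, dispKer_zero, le_bot_iff, Subgroup.map_eq_bot_iff_of_injective _
    (Subgroup.subtype_injective _)] at this
  exact ⟨_, this⟩

theorem Centralizes.mono {α α' β β' δ : RackCon Q} (hC : Centralizes α β δ)
    (hα : ∀ x y, α'.r x y → α.r x y) (hβ : ∀ x y, β'.r x y → β.r x y) : Centralizes α' β' δ :=
  fun m n t a b c d hab hcd =>
    hC m n t a b c d (fun i => hα _ _ (hab i)) (fun j => hβ _ _ (hcd j))

theorem eq_zero_of_rel_imp_eq {α : RackCon Q} (h : ∀ x y, α.r x y → x = y) : α = zero Q := by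
  obtain ⟨s, _, _⟩ := α
  have : s = (zero Q).toSetoid := Setoid.ext fun x y => ⟨h x y, fun e => e ▸ s.iseqv.refl x⟩
  subst this
  rfl

end RackCon

/-! ### From the group to its core: coset congruences -/

namespace GroupCore

variable {G : Type*} [Group G]

@[simp]
theorem val_act (x y : GroupCore G) : (x ◃ y).val = x.val * y.val⁻¹ * x.val := rfl

@[simp]
theorem val_invAct (x y : GroupCore G) : (x ◃⁻¹ y).val = x.val * y.val⁻¹ * x.val := rfl

/-- The congruence of the core of a group given by a normal subgroup. -/
def conOfNormal (N : Subgroup G) [N.Normal] : RackCon (GroupCore G) where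
  r x y := (x.val : G ⧸ N) = y.val
  iseqv := ⟨fun _ => rfl, fun h => h.symm, fun h k => h.trans k⟩
  act_congr h k := by simp [h, k]
  invAct_congr h k := by simp [h, k]

theorem conOfNormal_iff {N : Subgroup G} [N.Normal] {x y : GroupCore G} :
    (conOfNormal N).r x y ↔ x.val⁻¹ * y.val ∈ N :=
  QuotientGroup.eq

/-- The quadruples `(p, q, r, s)` with `p ≡ r` modulo `N`, `p ≡ q` and `r ≡ s` modulo `M`, and
`p⁻¹ q = r⁻¹ s`. -/
def squares (N M : Subgroup G) [N.Normal] [M.Normal] (h : ∀ x ∈ N, ∀ y ∈ M, x * y = y * x) :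
    Subgroup (G × G × G × G) where
  carrier := {w | w.2.2.1⁻¹ * w.1 ∈ N ∧ w.1⁻¹ * w.2.1 ∈ M ∧
    w.1⁻¹ * w.2.1 = w.2.2.1⁻¹ * w.2.2.2}
  one_mem' := by simp
  mul_mem' := by
    rintro ⟨p, q, r, s⟩ ⟨p', q', r', s'⟩ ⟨h₁, h₂, h₃⟩ ⟨k₁, k₂, k₃⟩
    simp only [Set.mem_ofPred_eq, Prod.mk_mul_mk] at *
    -- Every quadruple has the form `(r n, r n m, r, r m)` with `n ∈ N`, `m ∈ M`.
    obtain ⟨n, rfl⟩ : ∃ n, p = r * n := ⟨r⁻¹ * p, by group⟩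
    obtain ⟨n', rfl⟩ : ∃ n, p' = r' * n := ⟨r'⁻¹ * p', by group⟩
    obtain ⟨m, rfl⟩ : ∃ m, s = r * m := ⟨r⁻¹ * s, by group⟩
    obtain ⟨m', rfl⟩ : ∃ m, s' = r' * m := ⟨r'⁻¹ * s', by group⟩
    obtain rfl : q = r * n * m := by
      rw [inv_mul_cancel_left] at h₃; rw [← h₃]; group
    obtain rfl : q' = r' * n' * m' := by
      rw [inv_mul_cancel_left] at k₃; rw [← k₃]; group
    simp only [inv_mul_cancel_left] at h₁ k₁ h₂ k₂
    have hm : r'⁻¹ * m * r' ∈ M := by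
      simpa using Subgroup.Normal.conj_mem inferInstance m h₂ r'⁻¹
    -- Closure under products needs exactly that `n'` commutes with the conjugate of `m`.
    have e := h n' k₁ _ hm
    have e₁ : (r * n * (r' * n'))⁻¹ * (r * n * m * (r' * n' * m')) = r'⁻¹ * m * r' * m' := by
      calc _ = n'⁻¹ * ((r'⁻¹ * m * r') * n') * m' := by group
        _ = _ := by rw [← e]; group
    refine ⟨?_, ?_, ?_⟩
    · have : (r * r')⁻¹ * (r * n * (r' * n')) = (r'⁻¹ * n * r') * n' := by group
      rw [this]
      exact mul_mem (by simpa using Subgroup.Normal.conj_mem inferInstance n h₁ r'⁻¹) k₁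
    · rw [e₁]
      exact mul_mem hm k₂
    · rw [e₁]; group
  inv_mem' := by
    rintro ⟨p, q, r, s⟩ ⟨h₁, h₂, h₃⟩
    simp only [Set.mem_ofPred_eq, Prod.inv_mk, inv_inv] at *
    obtain ⟨n, rfl⟩ : ∃ n, p = r * n := ⟨r⁻¹ * p, by group⟩
    obtain ⟨m, rfl⟩ : ∃ m, s = r * m := ⟨r⁻¹ * s, by group⟩
    obtain rfl : q = r * n * m := by
      rw [inv_mul_cancel_left] at h₃; rw [← h₃]; group
    simp only [inv_mul_cancel_left] at h₁ h₂
    have e := h n h₁ _ (inv_mem h₂)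
    have e₁ : r * n * (r * n * m)⁻¹ = r * m⁻¹ * r⁻¹ := by
      calc _ = r * (n * m⁻¹) * n⁻¹ * r⁻¹ := by group
        _ = _ := by rw [e]; group
    refine ⟨?_, ?_, ?_⟩
    · have : r * (r * n)⁻¹ = r * n⁻¹ * r⁻¹ := by group
      rw [this]
      exact Subgroup.Normal.conj_mem inferInstance _ (inv_mem h₁) r
    · rw [e₁]
      exact Subgroup.Normal.conj_mem inferInstance _ (inv_mem h₂) r
    · rw [e₁]; group

/-- Both core operations are group words, so terms preserve subgroups of the fourth power. -/
theorem eval_mem {K X : Type*} [Group K] (f : G →* K) (S : Subgroup (K × K × K × K))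
    (p q r s : X → GroupCore G)
    (h : ∀ x, (f (p x).val, f (q x).val, f (r x).val, f (s x).val) ∈ S) (t : RackTerm X) :
    (f (t.eval p).val, f (t.eval q).val, f (t.eval r).val, f (t.eval s).val) ∈ S := by
  induction t with
  | var x => exact h x
  | act t u iht ihu =>
    simpa [RackTerm.eval] using mul_mem (mul_mem iht (inv_mem ihu)) iht
  | invAct t u iht ihu =>
    simpa [RackTerm.eval] using mul_mem (mul_mem iht (inv_mem ihu)) iht

theorem centralizes_conOfNormal (N M : Subgroup G) [N.Normal] [M.Normal] :
    RackCon.Centralizes (conOfNormal N) (conOfNormal M) (conOfNormal ⁅N, M⁆) := by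
  intro m n t a b c d hab hcd htac
  let f := QuotientGroup.mk' ⁅N, M⁆
  have hf : Function.Surjective f := QuotientGroup.mk'_surjective _
  have : (N.map f).Normal := Subgroup.Normal.map inferInstance f hf
  have : (M.map f).Normal := Subgroup.Normal.map inferInstance f hf
  have hcomm : ∀ x ∈ N.map f, ∀ y ∈ M.map f, x * y = y * x := by
    rintro _ ⟨x, hx, rfl⟩ _ ⟨y, hy, rfl⟩
    rw [← commutatorElement_eq_one_iff_mul_comm, ← map_commutatorElement]
    exact (QuotientGroup.eq_one_iff _).2 (Subgroup.commutator_mem_commutator hx hy)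
  have key := eval_mem f (squares (N.map f) (M.map f) hcomm) (Sum.elim a c) (Sum.elim a d)
    (Sum.elim b c) (Sum.elim b d) (by
      -- The variables give the quadruples `(a, a, b, b)` and `(c, d, c, d)`; in a square, `p = q`
      -- forces `r = s`.
      rintro (i | j)
      · refine ⟨⟨_, conOfNormal_iff.1 ((conOfNormal N).symm (hab i)), by simp⟩, ?_, ?_⟩ <;> simp
      · refine ⟨?_, ⟨_, conOfNormal_iff.1 (hcd j), by simp⟩, ?_⟩ <;> simp) t
  have h := key.2.2
  have h' : f (t.eval (Sum.elim a c)).val = f (t.eval (Sum.elim a d)).val := htac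
  simp only [h', inv_mul_cancel] at h
  exact inv_mul_eq_one.1 h.symm

theorem derivedSeries_rel_imp (n : ℕ) : ∀ x y : GroupCore G,
    (RackCon.derivedSeries (GroupCore G) n).r x y → (conOfNormal (derivedSeries G n)).r x y := by
  induction n with
  | zero => exact fun x y _ => conOfNormal_iff.2 (Subgroup.mem_top _)
  | succ n ih =>
    exact fun x y h => RackCon.commutator_le ((centralizes_conOfNormal _ _).mono ih ih) h

theorem lowerCentralSeries_rel_imp (n : ℕ) : ∀ x y : GroupCore G,
    (RackCon.lowerCentralSeries (GroupCore G) n).r x y →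
      (conOfNormal ((⊤ : Subgroup G).lowerCentralSeries n)).r x y := by
  induction n with
  | zero => exact fun x y _ => conOfNormal_iff.2 (Subgroup.mem_top _)
  | succ n ih =>
    exact fun x y h => RackCon.commutator_le ((centralizes_conOfNormal _ ⊤).mono ih
      fun x y _ => conOfNormal_iff.2 (Subgroup.mem_top _)) h

theorem eq_of_conOfNormal_eq_bot {N : Subgroup G} [N.Normal] (hN : N = ⊥) {x y : GroupCore G}
    (h : (conOfNormal N).r x y) : x = y := by
  rw [conOfNormal_iff, hN, Subgroup.mem_bot] at h
  exact GroupCore.ext (inv_mul_eq_one.1 h)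

theorem rackIsSolvable (h : Group.IsSolvable G) : RackIsSolvable (GroupCore G) := by
  obtain ⟨n, hn⟩ := h.solvable
  exact ⟨n, RackCon.eq_zero_of_rel_imp_eq fun x y hxy =>
    eq_of_conOfNormal_eq_bot hn (derivedSeries_rel_imp n x y hxy)⟩

theorem rackIsNilpotent (h : Group.IsNilpotent G) : RackIsNilpotent (GroupCore G) := by
  obtain ⟨n, hn⟩ := Subgroup.nilpotent_iff_lowerCentralSeries.1 h
  exact ⟨n, RackCon.eq_zero_of_rel_imp_eq fun x y hxy =>
    eq_of_conOfNormal_eq_bot hn (lowerCentralSeries_rel_imp n x y hxy)⟩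

/-! ### From the core back to the group: a central extension -/

/-- The action of `G × G` on the core of `G`, where `(a, b)` acts as `y ↦ a y b⁻¹`. -/
def prodAct (G : Type*) [Group G] : G × G →* Equiv.Perm (GroupCore G) where
  toFun w :=
    { toFun := fun y => ⟨w.1 * y.val * w.2⁻¹⟩
      invFun := fun y => ⟨w.1⁻¹ * y.val * w.2⟩
      left_inv := fun y => by ext; simp [mul_assoc]
      right_inv := fun y => by ext; simp [mul_assoc] }
  map_one' := by ext; simp
  map_mul' _ _ := by ext; simp [mul_assoc]

theorem prodAct_apply (w : G × G) (y : GroupCore G) :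
    prodAct G w y = ⟨w.1 * y.val * w.2⁻¹⟩ := rfl

/-- The subgroup of `G × G` generated by the pairs `(x, x⁻¹)`. -/
def antidiagonal (G : Type*) [Group G] : Subgroup (G × G) :=
  Subgroup.closure (Set.range fun x : G => (x, x⁻¹))

theorem mem_antidiagonal (x : G) : (x, x⁻¹) ∈ antidiagonal G :=
  Subgroup.subset_closure ⟨x, rfl⟩

theorem antidiagonal_le_comap_disp :
    antidiagonal G ≤ (RackCon.disp (GroupCore G)).comap (prodAct G) := by
  rw [antidiagonal, Subgroup.closure_le]
  rintro _ ⟨x, rfl⟩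
  -- Both sides send `y` to `x y x`, as `L_1` is inversion.
  have : prodAct G (x, x⁻¹) = Rack.act' (⟨x⟩ : GroupCore G) * (Rack.act' ⟨1⟩)⁻¹ := by
    ext y
    simp [prodAct_apply]
  rw [SetLike.mem_coe, Subgroup.mem_comap, this]
  exact RackCon.act'_mul_inv_mem_relDisp _ trivial

/-- The homomorphism from the antidiagonal subgroup to the displacement group of the core. -/
def toDisp (G : Type*) [Group G] : antidiagonal G →* RackCon.disp (GroupCore G) :=
  ((prodAct G).comp (antidiagonal G).subtype).codRestrict _
    fun w => antidiagonal_le_comap_disp w.2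

theorem ker_toDisp_le_center : (toDisp G).ker ≤ Subgroup.center (antidiagonal G) := by
  rintro ⟨⟨a, b⟩, hw⟩ h
  have hy (y : G) : a * y * b⁻¹ = y := by
    have := congrArg (fun g => (g.val (⟨y⟩ : GroupCore G)).val) (MonoidHom.mem_ker.1 h)
    exact this
  -- Evaluating at `y = 1` gives `a = b`; the other values of `y` make `a` central in `G`.
  obtain rfl : a = b := by simpa [mul_inv_eq_one] using hy 1
  refine Subgroup.mem_center_iff.2 fun g => Subtype.ext (Prod.ext ?_ ?_)
  · exact (mul_inv_eq_iff_eq_mul.1 (hy g.1.1)).symm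
  · exact (mul_inv_eq_iff_eq_mul.1 (hy g.1.2)).symm

/-- The first projection of the antidiagonal subgroup. -/
def antidiagonalFst (G : Type*) [Group G] : antidiagonal G →* G :=
  (MonoidHom.fst G G).comp (antidiagonal G).subtype

theorem antidiagonalFst_surjective : Function.Surjective (antidiagonalFst G) :=
  fun x => ⟨⟨_, mem_antidiagonal x⟩, rfl⟩

theorem isNilpotent (h : RackIsNilpotent (GroupCore G)) : Group.IsNilpotent G := by
  have := RackCon.isNilpotent_disp h
  have : Group.IsNilpotent (antidiagonal G) :=
    Subgroup.isNilpotent_of_ker_le_center (toDisp G) ker_toDisp_le_center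
  exact Group.nilpotent_of_surjective _ antidiagonalFst_surjective

theorem isSolvable (h : RackIsSolvable (GroupCore G)) : Group.IsSolvable G := by
  have := RackCon.isSolvable_disp h
  have hker : Group.IsSolvable (toDisp G).ker :=
    Group.isSolvable_of_comm fun a b =>
      Subtype.ext (Subgroup.mem_center_iff.1 (ker_toDisp_le_center b.2) a.1)
  have : Group.IsSolvable (antidiagonal G) :=
    Group.isSolvable_of_ker_le_range (toDisp G).ker.subtype (toDisp G) (by simp)
  exact Group.isSolvable_of_surjective antidiagonalFst_surjective

end GroupCore

theorem mainTheorem5 (G : Type*) [Group G] :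
    (RackIsSolvable (GroupCore G) ↔ Group.IsSolvable G) ∧
      (RackIsNilpotent (GroupCore G) ↔ Group.IsNilpotent G) :=
  ⟨⟨GroupCore.isSolvable, GroupCore.rackIsSolvable⟩,
    ⟨GroupCore.isNilpotent, GroupCore.rackIsNilpotent⟩⟩
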